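/- A t.d.l.c.s.c. group is a totally disconnected, locally compact, second countable Hausdorff topological group. A t.d.l.c.s.c. group $H$ is a normal compression of a t.d.l.c.s.c. group $G$ if there is an injective continuous homomorphism $\psi\colon G\to H$ whose image is dense and normal in $H$. The class $\mathscr{E}$ of elementary groups is the smallest class of t.d.l.c.s.c. groups (closed under topological isomorphism) that contains all second countable profinite groups and all countable discrete groups, and is closed under taking closed subgroups, Hausdorff quotients, and group extensions, and under countable increasing unions: if $G$ is a t.d.l.c.s.c. group and $G=\bigcup_{i\in\mathbb{N}}O_i$ for an increasing sequence of open subgroups $O_i\in\mathscr{E}$, then $G\in\mathscr{E}$. For a topological group $G$ let $\mathrm{Res}(G)$ denote the intersection of all open normal subgroups of $G$. The decomposition rank $\xi$ is the partial function from the class of t.d.l.c.s.c. groups to the ordinals in $[1,\omega_1)$ such that $\xi(G)=1$ if and only if $G$ is trivial, and such that, whenever $G$ is non-trivial and is the union of an increasing sequence $(O_i)_{i\in\mathbb{N}}$ of compactly generated open subgroups, $\xi(G)$ is defined if and only if $\xi(\mathrm{Res}(O_i))$ is defined for all $i$, in which case $$\xi(G)=\sup_{i\in\mathbb{N}}\xi(\mathrm{Res}(O_i))+1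 .$$ (There is exactly one such partial function, and it is defined exactly on $\mathscr{E}$; by convention $\xi(G)=\omega_1$ if $G$ is not elementary.) **Proposition 5.3.** Let $G$ and $H$ be t.d.l.c.s.c. groups such that $H$ is a normal compression of $G$, and let $\alpha$ be an ordinal. Then $G$ is elementary with $\xi(G)=\alpha$ if and only if $H$ is elementary with $\xi(H)=\alpha$. -/

import Mathlib

universe u

/-- Totally disconnected, locally compact, second countable (Hausdorff) topological groups. -/
class IsTDLCSC (G : Type u) [Group G] [TopologicalSpace G] : Prop extends
  IsTopologicalGroup G, T2Space G, TotallyDisconnectedSpace G, LocallyCompactSpace G,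
  SecondCountableTopology G

/-- A normal compression map: an injective continuous homomorphism with dense normal image. -/
structure IsNormalCompressionMap {G H : Type u} [Group G] [TopologicalSpace G]
    [Group H] [TopologicalSpace H] (ψ : G →* H) : Prop where
  continuous : Continuous ψ
  injective : Function.Injective ψ
  denseRange : DenseRange ψ
  normal_range : ψ.range.Normal

/-- `H` is a normal compression of `G`. -/
def IsNormalCompression (H G : Type u) [Group G] [TopologicalSpace G]
    [Group H] [TopologicalSpace H] : Prop :=
  ∃ ψ : G →* H, IsNormalCompressionMap ψ

/-- The class of elementary groups: the smallest class of t.d.l.c.s.c. groups (understood up to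
topological isomorphism) that contains the second countable profinite groups and the countable
discrete groups and is closed under closed subgroups, Hausdorff quotients, group extensions and
countable increasing unions of open subgroups. -/
inductive IsElementary : (G : Type u) → [Group G] → [TopologicalSpace G] → Prop
  | profinite (G : Type u) [Group G] [TopologicalSpace G] [IsTDLCSC G] [CompactSpace G] :
      IsElementary G
  | discrete (G : Type u) [Group G] [TopologicalSpace G] [DiscreteTopology G] [Countable G] :
      IsElementary G
  | congr (G H : Type u) [Group G] [TopologicalSpace G] [Group H] [TopologicalSpace H]
      (e : G ≃ₜ* H) : IsElementary G → IsElementary H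
  | closedSubgroup (G : Type u) [Group G] [TopologicalSpace G] (H : Subgroup G)
      (hH : IsClosed (H : Set G)) : IsElementary G → IsElementary H
  | quotient (G : Type u) [Group G] [TopologicalSpace G] (N : Subgroup G) [N.Normal]
      (hN : IsClosed (N : Set G)) : IsElementary G → IsElementary (G ⧸ N)
  | extension (G : Type u) [Group G] [TopologicalSpace G] [IsTDLCSC G] (N : Subgroup G)
      [N.Normal] (hN : IsClosed (N : Set G)) :
      IsElementary N → IsElementary (G ⧸ N) → IsElementary G
  | union (G : Type u) [Group G] [TopologicalSpace G] [IsTDLCSC G] (O : ℕ → Subgroup G)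
      (mono : Monotone O) (isOpen : ∀ i, IsOpen (O i : Set G)) (cover : ∀ g : G, ∃ i, g ∈ O i) :
      (∀ i, IsElementary (O i)) → IsElementary G

/-- The discrete residual `Res(G)`: the intersection of all open normal subgroups of `G`. -/
def discreteResidual (G : Type u) [Group G] [TopologicalSpace G] : Subgroup G :=
  sInf {N : Subgroup G | N.Normal ∧ IsOpen (N : Set G)}

/-- `O` is an increasing sequence of compactly generated open subgroups with union `G`. -/
structure IsCompGenExhaustion {G : Type u} [Group G] [TopologicalSpace G]
    (O : ℕ → Subgroup G) : Prop where
  mono : Monotone O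
  isOpen : ∀ i, IsOpen (O i : Set G)
  compactlyGenerated : ∀ i, ∃ K : Set G, IsCompact K ∧ Subgroup.closure K = O i
  cover : ∀ g : G, ∃ i, g ∈ O i

/-- The graph of the decomposition rank: the least relation with `ξ(1) = 1` and
`ξ(G) = sup ξ(Res(O i)) + 1` for `G` non-trivial and exhausted by the compactly generated open
subgroups `O i`. It is single-valued, see `HasDecompositionRank.unique`. -/
inductive HasDecompositionRank :
    (G : Type u) → [Group G] → [TopologicalSpace G] → Ordinal.{0} → Prop
  | trivial (G : Type u) [Group G] [TopologicalSpace G] [IsTDLCSC G] [Subsingleton G] :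
      HasDecompositionRank G 1
  | step (G : Type u) [Group G] [TopologicalSpace G] [IsTDLCSC G] [Nontrivial G]
      (O : ℕ → Subgroup G) (hO : IsCompGenExhaustion O) (β : ℕ → Ordinal.{0})
      (hβ : ∀ i, HasDecompositionRank (discreteResidual (O i)) (β i)) :
      HasDecompositionRank G ((⨆ i, β i) + 1)

/-- The rank does not increase along continuous injective homomorphisms. -/
theorem HasDecompositionRank.le_of_injective {G : Type u} [Group G] [TopologicalSpace G]
    {α : Ordinal.{0}} (hG : HasDecompositionRank G α) :
    ∀ {H : Type u} [Group H] [TopologicalSpace H] {β : Ordinal.{0}},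
      HasDecompositionRank H β → ∀ ψ : H →* G, Continuous ψ → Function.Injective ψ → β ≤ α := by
  induction hG with
  | trivial G =>
    intro H _ _ β hH ψ _ hi
    cases hH with
    | trivial => exact le_rfl
    | step O hO β hβ => exact absurd hi.subsingleton (not_subsingleton H)
  | step G O hO β hβ ih =>
    intro H _ _ γ hH ψ hc hi
    cases hH with
    | trivial => simp
    | step _ W hW γ hγ =>
      have key : ∀ j, γ j ≤ ⨆ i, β i := by
        intro j
        obtain ⟨K, hK, hKW⟩ := hW.compactlyGenerated j
        obtain ⟨i, hi'⟩ := (hK.image hc).elim_directed_cover (fun i => (O i : Set G)) hO.isOpen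
          (fun g _ => Set.mem_iUnion.2 (hO.cover g))
          (Monotone.directed_le fun a b hab => hO.mono hab)
        have hle : W j ≤ (O i).comap ψ := by
          rw [← hKW, Subgroup.closure_le]
          exact fun k hk => hi' ⟨k, hk, rfl⟩
        let ψ₁ : W j →* O i := (ψ.comp (W j).subtype).codRestrict (O i) (fun x => hle x.2)
        have hc₁ : Continuous ψ₁ :=
          Continuous.subtype_mk (hc.comp continuous_subtype_val) (fun x => hle x.2)
        have hi₁ : Function.Injective ψ₁ := fun a b hab =>
          Subtype.ext (hi (congrArg Subtype.val hab))
        have hres : ∀ x : discreteResidual (W j),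
            (ψ₁.comp (discreteResidual (W j)).subtype) x ∈ discreteResidual (O i) := by
          intro x
          refine Subgroup.mem_sInf.2 fun N hN => ?_
          have := hN.1
          exact Subgroup.mem_sInf.1 x.2 (N.comap ψ₁) ⟨inferInstance, hN.2.preimage hc₁⟩
        refine (ih i (hγ j) ((ψ₁.comp (discreteResidual (W j)).subtype).codRestrict _ hres)
          ?_ ?_).trans (le_ciSup Ordinal.bddAbove_of_small i)
        · exact Continuous.subtype_mk (hc₁.comp continuous_subtype_val) hres
        · exact fun a b hab => Subtype.ext (hi₁ (congrArg Subtype.val hab))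
      exact add_le_add (ciSup_le key) le_rfl

/-- A group has at most one decomposition rank. -/
theorem HasDecompositionRank.unique {G : Type u} [Group G] [TopologicalSpace G]
    {α β : Ordinal.{0}} (hα : HasDecompositionRank G α) (hβ : HasDecompositionRank G β) :
    α = β :=
  le_antisymm (hβ.le_of_injective hα (MonoidHom.id G) continuous_id Function.injective_id)
    (hα.le_of_injective hβ (MonoidHom.id G) continuous_id Function.injective_id)

open Classical in
/-- The decomposition rank `ξ(G)`, extended by the value `ω₁` to the groups without a rank. -/
noncomputable def decompositionRank (G : Type u) [Group G] [TopologicalSpace G] : Ordinal.{0} :=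
  if h : ∃ α, HasDecompositionRank G α then h.choose else Ordinal.omega 1

/-- The function `decompositionRank` agrees with the relation `HasDecompositionRank`. -/
theorem HasDecompositionRank.decompositionRank_eq {G : Type u} [Group G] [TopologicalSpace G]
    {α : Ordinal.{0}} (hα : HasDecompositionRank G α) : decompositionRank G = α := by
  have h : ∃ α, HasDecompositionRank G α := ⟨α, hα⟩
  rw [decompositionRank, dif_pos h]
  exact h.choose_spec.unique hα

/-! Rank and elementarity transfer separately along a normal compression `ψ : G →* H`. Both
arguments use that the conjugation action of `H` on `G` is jointly continuous (`continuous_conjAut`,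
a Baire category argument) and that `H = V ψ(G)` for every compact open subgroup `V`.

Rank: it is monotone along continuous injections, so only existence with a bound is needed.
`HasDecompositionRank.exists_le_of_normalCompression` gives this by induction on a ranked group `X`
into which `G` injects; the auxiliary `X` serves both directions (`X = G` and `X = H`). Exhaust `G`
by `V`-invariant compactly generated open `O n`; then the groups `V ψ(O n)` exhaust `H`. The crux,
`discreteResidual_le_closure`, makes `Res(V ψ(O n))` a normal compression of `Res(O n)`, and the
latter injects into a residual occurring in the rank of `X`.

Elementarity: it passes to any t.d.l.c.s.c. group injecting continuously into an elementary one
(`IsElementary.of_injective`). Conversely, `H` is a quotient of `G ⋊ V`, an extension of the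
profinite group `V` by `G`. -/

open Topology Pointwise

/-! ### Compact open subgroups and the discrete residual. -/

section TopologicalGroups

variable {G : Type*} [Group G] [TopologicalSpace G]

/-- Van Dantzig's theorem. -/
theorem exists_compact_open_subgroup_subset [IsTopologicalGroup G] [T2Space G]
    [LocallyCompactSpace G] [TotallyDisconnectedSpace G] {U : Set G} (hU : U ∈ 𝓝 (1 : G)) :
    ∃ V : Subgroup G, IsOpen (V : Set G) ∧ IsCompact (V : Set G) ∧ (V : Set G) ⊆ U := by
  obtain ⟨K, hK, hK1, hKU⟩ := exists_compact_subset isOpen_interior (mem_interior_iff_mem_nhds.2 hU)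
  obtain ⟨W, hW, hW1, hWK⟩ := loc_compact_Haus_tot_disc_of_zero_dim.mem_nhds_iff.1
    (isOpen_interior.mem_nhds hK1)
  have hWc : IsCompact W := hK.of_isClosed_subset hW.1 (hWK.trans interior_subset)
  -- The stabilizer of the compact open set `W` under right translation: it is open because a
  -- compact set stays inside an open one under small translations, and it lies in `W` because `1 ∈
  -- W`.
  let V : Subgroup G :=
    { carrier := {g | ∀ w, w * g ∈ W ↔ w ∈ W}
      one_mem' := fun w => by simp
      mul_mem' := fun {a b} ha hb w => by rw [← mul_assoc, hb, ha]
      inv_mem' := fun {a} ha w => by rw [← ha, inv_mul_cancel_right] }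
  obtain ⟨T, hT, hWT⟩ := compact_open_separated_mul_right hWc hW.2 subset_rfl
  have hVo : IsOpen (V : Set G) := by
    refine V.isOpen_of_mem_nhds (g := 1) (Filter.mem_of_superset
      (Filter.inter_mem hT (inv_mem_nhds_one G hT)) fun t ht w => ⟨fun h => ?_, fun h => ?_⟩)
    · simpa using hWT (Set.mul_mem_mul h ht.2)
    · exact hWT (Set.mul_mem_mul h ht.1)
  have hVW : (V : Set G) ⊆ W := fun v hv => by simpa using (hv 1).2 hW1
  exact ⟨V, hVo, hWc.of_isClosed_subset (V.isClosed_of_isOpen hVo) hVW,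
    (hVW.trans (hWK.trans interior_subset)).trans (hKU.trans interior_subset)⟩

theorem IsTDLCSC.subgroup [IsTDLCSC G] {N : Subgroup G} (hN : IsClosed (N : Set G)) :
    IsTDLCSC N :=
  { (inferInstance : IsTopologicalGroup N), (inferInstance : T2Space N),
    (inferInstance : TotallyDisconnectedSpace N) with
    toSecondCountableTopology := IsInducing.subtypeVal.secondCountableTopology
    toLocallyCompactSpace := hN.isClosedEmbedding_subtypeVal.locallyCompactSpace }

theorem IsTDLCSC.of_equiv {H : Type*} [Group H] [TopologicalSpace H] [IsTDLCSC G] (e : G ≃ₜ* H) :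
    IsTDLCSC H :=
  { toIsTopologicalGroup := e.symm.isInducing.topologicalGroup e.symm
    toT2Space := e.toHomeomorph.t2Space
    toTotallyDisconnectedSpace := e.toHomeomorph.totallyDisconnectedSpace
    toLocallyCompactSpace := e.toHomeomorph.symm.isClosedEmbedding.locallyCompactSpace
    toSecondCountableTopology := e.symm.isInducing.secondCountableTopology }

theorem IsTDLCSC.quotient [IsTDLCSC G] {N : Subgroup G} [N.Normal] (hN : IsClosed (N : Set G)) :
    IsTDLCSC (G ⧸ N) := by
  have : T2Space (G ⧸ N) := inferInstance
  refine { (inferInstance : IsTopologicalGroup (G ⧸ N)), (inferInstance : T2Space (G ⧸ N)),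
    (inferInstance : LocallyCompactSpace (G ⧸ N)),
    (inferInstance : SecondCountableTopology (G ⧸ N)) with
    toTotallyDisconnectedSpace := ?_ }
  have : NonarchimedeanGroup (G ⧸ N) := ⟨fun U hU => by
    obtain ⟨V, hV, -, hVU⟩ := exists_compact_open_subgroup_subset
      (QuotientGroup.continuous_mk.continuousAt.preimage_mem_nhds
        (show U ∈ 𝓝 ((1 : G) : G ⧸ N) from hU))
    refine ⟨⟨V.map (QuotientGroup.mk' N), QuotientGroup.isOpenMap_coe _ hV⟩, ?_⟩
    rintro _ ⟨v, hv, rfl⟩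
    exact hVU hv⟩
  infer_instance

theorem IsTDLCSC.prod {H : Type*} [Group H] [TopologicalSpace H] [IsTDLCSC G] [IsTDLCSC H] :
    IsTDLCSC (G × H) :=
  { (inferInstance : IsTopologicalGroup (G × H)), (inferInstance : T2Space (G × H)),
    (inferInstance : TotallyDisconnectedSpace (G × H)),
    (inferInstance : SecondCountableTopology (G × H)),
    (inferInstance : LocallyCompactSpace (G × H)) with }

theorem discreteResidual_le {N : Subgroup G} (hn : N.Normal) (hN : IsOpen (N : Set G)) :
    discreteResidual G ≤ N :=
  sInf_le ⟨hn, hN⟩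

instance discreteResidual_normal : (discreteResidual G).Normal :=
  ⟨fun n hn g => Subgroup.mem_sInf.2 fun N hN => hN.1.conj_mem n (Subgroup.mem_sInf.1 hn N hN) g⟩

theorem isClosed_discreteResidual [IsTopologicalGroup G] :
    IsClosed (discreteResidual G : Set G) := by
  rw [discreteResidual, Subgroup.coe_sInf]
  exact isClosed_biInter fun N hN => N.isClosed_of_isOpen hN.2

theorem Subgroup.normal_of_closure_eq_top {G : Type*} [Group G] {K : Set G}
    (hK : Subgroup.closure K = ⊤) (L : Subgroup G)
    (h : ∀ k ∈ K ∪ K⁻¹, ∀ x ∈ L, k * x * k⁻¹ ∈ L) : L.Normal := by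
  rw [← Subgroup.normalizer_eq_top_iff, eq_top_iff, ← hK, Subgroup.closure_le]
  refine fun k hk => Subgroup.mem_normalizer_iff.2 fun x => ⟨h k (.inl hk) x, fun hx => ?_⟩
  simpa [mul_assoc] using h k⁻¹ (.inr (by simpa using hk)) _ hx

/-- In a compactly generated group, every compact open subgroup contains an open normal subgroup
modulo the discrete residual. -/
theorem exists_open_normal_le_sup_discreteResidual [IsTopologicalGroup G]
    {K : Set G} (hK : IsCompact K) (hKG : Subgroup.closure K = ⊤)
    {U : Subgroup G} (hU : IsOpen (U : Set G)) (hUc : IsCompact (U : Set G)) :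
    ∃ L : Subgroup G, L.Normal ∧ IsOpen (L : Set G) ∧ L ≤ U ⊔ discreteResidual G := by
  set R := discreteResidual G
  have hURo : IsOpen ((U ⊔ R : Subgroup G) : Set G) := Subgroup.isOpen_mono le_sup_left hU
  -- The conjugates of `U` by generators and their inverses form a compact set. Its part outside the
  -- open subgroup `UR` misses `R`, a directed intersection of clopen normal subgroups, so a single
  -- `N` already misses it; then `N ∩ UR` is stable under the generators.
  let D : Set G := (fun p : G × G => p.1 * p.2 * p.1⁻¹) '' ((K ∪ K⁻¹) ×ˢ (U : Set G))
  have hD : IsCompact D :=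
    ((hK.union hK.inv).prod hUc).image (by fun_prop)
  have hD' : IsCompact (D \ (U ⊔ R : Subgroup G)) := hD.diff hURo
  let S := {N : Subgroup G | N.Normal ∧ IsOpen (N : Set G)}
  have : Nonempty S := ⟨⟨⊤, inferInstance, isOpen_univ⟩⟩
  obtain ⟨⟨N, hNn, hNo⟩, hN⟩ := hD'.elim_directed_family_closed
    (fun N : S => ((N : Subgroup G) : Set G)) (fun N => N.1.isClosed_of_isOpen N.2.2) (by
      refine Set.eq_empty_iff_forall_notMem.2 fun x hx => hx.1.2 (Subgroup.mem_sup_right ?_)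
      exact Subgroup.mem_sInf.2 fun N hN => Set.mem_iInter.1 hx.2 ⟨N, hN⟩) (by
      rintro ⟨N, hNn, hNo⟩ ⟨N', hNn', hNo'⟩
      exact ⟨⟨N ⊓ N', inferInstance, hNo.inter hNo'⟩, fun x hx => hx.1, fun x hx => hx.2⟩)
  have hRN : R ≤ N := discreteResidual_le hNn hNo
  refine ⟨N ⊓ (U ⊔ R), ?_, hNo.inter hURo, inf_le_right⟩
  refine Subgroup.normal_of_closure_eq_top hKG _ fun k hk x hx => ⟨hNn.conj_mem x hx.1 k, ?_⟩
  obtain ⟨u, hu, r, hr, rfl⟩ := Subgroup.mem_sup_of_normal_right.1 hx.2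
  have huN : u ∈ N := (N.mul_mem_cancel_right (hRN hr)).1 hx.1
  have h₁ : k * u * k⁻¹ ∈ U ⊔ R := by
    by_contra h
    exact Set.eq_empty_iff_forall_notMem.1 hN _
      ⟨⟨⟨(k, u), ⟨hk, hu⟩, rfl⟩, h⟩, hNn.conj_mem u huN k⟩
  have h₂ : k * r * k⁻¹ ∈ U ⊔ R :=
    Subgroup.mem_sup_right (discreteResidual_normal.conj_mem r hr k)
  simpa [mul_assoc] using mul_mem h₁ h₂

end TopologicalGroups

/-! ### Continuity of the conjugation action. -/

section ConjugationAction

variable {A B : Type*} [Group A] [Group B]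

/-- The action of `B` on `A` induced by conjugation on a normal subgroup isomorphic to `A`. -/
noncomputable def conjAut (ψ : A →* B) (hi : Function.Injective ψ) (hn : ψ.range.Normal) :
    B →* MulAut A :=
  (MulAut.congr (MonoidHom.ofInjective hi).symm).toMonoidHom.comp
    (MulAut.conjNormal (H := ψ.range))

variable {ψ : A →* B} (hi : Function.Injective ψ) (hn : ψ.range.Normal)

@[simp]
theorem map_conjAut (b : B) (a : A) : ψ (conjAut ψ hi hn b a) = b * ψ a * b⁻¹ := by
  have h : ∀ x : ψ.range, ψ ((MonoidHom.ofInjective hi).symm x) = x := fun x => by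
    rw [← MonoidHom.ofInjective_apply hi, MulEquiv.apply_symm_apply]
  change ψ ((MonoidHom.ofInjective hi).symm
    (MulAut.conjNormal b (MonoidHom.ofInjective hi a))) = _
  rw [h, MulAut.conjNormal_apply, MonoidHom.ofInjective_apply]

variable [TopologicalSpace A] [TopologicalSpace B]

/-- A map into a `σ`-compact space whose composition with an injective continuous map is
continuous has a point of continuity. -/
theorem exists_continuousAt_of_comp_continuous {X Y Z : Type*} [TopologicalSpace X] [BaireSpace X]
    [Nonempty X] [TopologicalSpace Y] [SigmaCompactSpace Y] [TopologicalSpace Z] [T2Space Z]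
    {p : Y → Z} (hp : Continuous p) (hpi : Function.Injective p) {f : X → Y}
    (hf : Continuous (p ∘ f)) : ∃ x, ContinuousAt f x := by
  let C := compactCovering Y
  -- Hence the preimages of the compact pieces are closed and Baire gives one with interior; on a
  -- compact piece `p` is an embedding, so `f` is continuous there.
  have hpre : ∀ n, f ⁻¹' C n = (p ∘ f) ⁻¹' (p '' C n) := fun n => by
    rw [Set.preimage_comp, Set.preimage_image_eq _ hpi]
  obtain ⟨n, x, hx⟩ := nonempty_interior_of_iUnion_of_closed (f := fun n => f ⁻¹' C n)
    (fun n => by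
      rw [hpre]
      exact ((isCompact_compactCovering Y n).image hp).isClosed.preimage hf)
    (by rw [← Set.preimage_iUnion, iUnion_compactCovering, Set.preimage_univ])
  refine ⟨x, ?_⟩
  have hC : CompactSpace (C n) := isCompact_iff_compactSpace.1 (isCompact_compactCovering Y n)
  have hemb : IsEmbedding (fun y : C n => p y) :=
    ((hp.comp continuous_subtype_val).isClosedEmbedding
      (hpi.comp Subtype.val_injective)).isEmbedding
  have hon : ContinuousOn f (f ⁻¹' C n) := by
    rw [continuousOn_iff_continuous_domRestrict]
    have : Continuous (fun x : f ⁻¹' C n => (⟨f x, x.2⟩ : C n)) :=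
      hemb.continuous_iff.2 (hf.comp continuous_subtype_val)
    exact continuous_subtype_val.comp this
  exact hon.continuousAt (mem_interior_iff_mem_nhds.1 hx)

variable [IsTDLCSC A] [IsTDLCSC B]

/-- Composing with `ψ` gives ordinary conjugation, so there is a point of continuity;
multiplicativity carries it to every point. -/
theorem continuous_conjAut_apply (hc : Continuous ψ) (b : B) : Continuous (conjAut ψ hi hn b) := by
  obtain ⟨x, hx⟩ := exists_continuousAt_of_comp_continuous (f := conjAut ψ hi hn b) hc hi (by
    have : ψ ∘ conjAut ψ hi hn b = fun a => b * ψ a * b⁻¹ := funext fun a => by simp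
    rw [this]
    fun_prop)
  refine continuous_iff_continuousAt.2 fun a => ?_
  have h : ⇑(conjAut ψ hi hn b) =
      fun a' => conjAut ψ hi hn b (a * x⁻¹) * conjAut ψ hi hn b (x * a⁻¹ * a') :=
    funext fun a' => by
      rw [← map_mul]
      group
  rw [h]
  refine continuousAt_const.mul (ContinuousAt.comp (g := conjAut ψ hi hn b)
    (f := fun a' => x * a⁻¹ * a') ?_ (by fun_prop))
  simpa using hx

theorem continuous_conjAut_left (hc : Continuous ψ) (a : A) :
    Continuous (fun b => conjAut ψ hi hn b a) := by
  obtain ⟨x, hx⟩ := exists_continuousAt_of_comp_continuous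
    (f := fun b => conjAut ψ hi hn b a) hc hi (by
      have : (ψ ∘ fun b => conjAut ψ hi hn b a) = fun b => b * ψ a * b⁻¹ := funext fun b => by simp
      rw [this]
      fun_prop)
  refine continuous_iff_continuousAt.2 fun b => ?_
  have h : (fun b' => conjAut ψ hi hn b' a) =
      fun b' => conjAut ψ hi hn (b * x⁻¹) (conjAut ψ hi hn (x * b⁻¹ * b') a) := funext fun b' => by
    rw [← MulAut.mul_apply, ← map_mul]
    group
  rw [h]
  refine (continuous_conjAut_apply hi hn hc _).continuousAt.comp
    (ContinuousAt.comp (g := fun b => conjAut ψ hi hn b a)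
      (f := fun b' => x * b⁻¹ * b') ?_ (by fun_prop))
  simpa using hx

/-- The conjugation action of `B` on `A` is jointly continuous. -/
theorem continuous_conjAut (hc : Continuous ψ) :
    Continuous (fun p : B × A => conjAut ψ hi hn p.1 p.2) := by
  obtain ⟨⟨x, y⟩, hx⟩ := exists_continuousAt_of_comp_continuous
    (f := fun p : B × A => conjAut ψ hi hn p.1 p.2) hc hi (by
      have : (ψ ∘ fun p : B × A => conjAut ψ hi hn p.1 p.2) = fun p => p.1 * ψ p.2 * p.1⁻¹ :=
        funext fun p => by simp
      rw [this]
      fun_prop)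
  refine continuous_iff_continuousAt.2 fun ⟨b, a⟩ => ?_
  -- The inner argument takes `(b, a)` to the known point of continuity `(x, y)`. The outer
  -- automorphism is fixed, and the correcting factor depends on `p.1` alone, so separate continuity
  -- handles both.
  have h : (fun p : B × A => conjAut ψ hi hn p.1 p.2) =
      fun p => conjAut ψ hi hn (b * x⁻¹) (conjAut ψ hi hn (x * b⁻¹ * p.1) (p.2 * (a⁻¹ * y))) *
        conjAut ψ hi hn p.1 (y⁻¹ * a) := funext fun p => by
    rw [← MulAut.mul_apply, ← map_mul, show b * x⁻¹ * (x * b⁻¹ * p.1) = p.1 by group, ← map_mul]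
    congr 1
    group
  rw [h]
  refine ContinuousAt.mul ((continuous_conjAut_apply hi hn hc _).continuousAt.comp
    (ContinuousAt.comp (g := fun p : B × A => conjAut ψ hi hn p.1 p.2)
      (f := fun p : B × A => (x * b⁻¹ * p.1, p.2 * (a⁻¹ * y))) ?_ (by fun_prop)))
    ((continuous_conjAut_left hi hn hc _).comp continuous_fst).continuousAt
  simpa using hx

end ConjugationAction

/-! ### Residuals of cocompact normal images, and invariant exhaustions. -/

section Residual

theorem exists_open_le_normalized {B : Type*} [Group B] [TopologicalSpace B] [IsTDLCSC B]
    {V : Subgroup B} (hV : IsOpen (V : Set B)) (hVc : IsCompact (V : Set B)) {U : Set B}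
    (hU : U ∈ 𝓝 (1 : B)) :
    ∃ W : Subgroup B, IsOpen (W : Set B) ∧ (W : Set B) ⊆ U ∧
      ∀ v ∈ V, ∀ w ∈ W, v * w * v⁻¹ ∈ W := by
  have : CompactSpace V := isCompact_iff_compactSpace.1 hVc
  obtain ⟨W, hW⟩ := ProfiniteGrp.exist_openNormalSubgroup_sub_open_nhds_of_one
    (G := V) (U := Subtype.val ⁻¹' interior U) (isOpen_interior.preimage continuous_subtype_val)
    (mem_interior_iff_mem_nhds.2 hU)
  refine ⟨W.toSubgroup.map V.subtype, hV.isOpenMap_subtype_val _ W.isOpen, ?_, ?_⟩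
  · rintro _ ⟨w, hw, rfl⟩
    exact interior_subset (hW hw)
  · rintro v hv _ ⟨w, hw, rfl⟩
    exact ⟨_, W.isNormal'.conj_mem w hw ⟨v, hv⟩, rfl⟩

theorem map_discreteResidual_le {A B : Type*} [Group A] [TopologicalSpace A] [Group B]
    [TopologicalSpace B] {ψ : A →* B} (hc : Continuous ψ) :
    (discreteResidual A).map ψ ≤ discreteResidual B := by
  rintro _ ⟨a, ha, rfl⟩
  refine Subgroup.mem_sInf.2 fun N hN => ?_
  exact Subgroup.mem_sInf.1 ha (N.comap ψ) ⟨hN.1.comap _, hN.2.preimage hc⟩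

variable {A B : Type*} [Group A] [TopologicalSpace A] [IsTDLCSC A]
  [Group B] [TopologicalSpace B] [IsTDLCSC B]

/-- Continuous automorphisms pull open normal subgroups back to open normal subgroups. -/
theorem conjAut_mem_discreteResidual {ψ : A →* B} (hc : Continuous ψ) (hi : Function.Injective ψ)
    (hn : ψ.range.Normal) (b : B) {a : A} (ha : a ∈ discreteResidual A) :
    conjAut ψ hi hn b a ∈ discreteResidual A := by
  refine Subgroup.mem_sInf.2 fun N hN => ?_
  exact Subgroup.mem_sInf.1 ha (N.comap (conjAut ψ hi hn b).toMonoidHom)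
    ⟨hN.1.comap _, hN.2.preimage (continuous_conjAut_apply hi hn hc b)⟩

theorem map_discreteResidual_normal {ψ : A →* B} (hc : Continuous ψ) (hi : Function.Injective ψ)
    (hn : ψ.range.Normal) : ((discreteResidual A).map ψ).Normal := by
  refine ⟨?_⟩
  rintro _ ⟨a, ha, rfl⟩ b
  exact ⟨_, conjAut_mem_discreteResidual hc hi hn b ha, map_conjAut hi hn b a⟩

/-- If `A` is compactly generated and its image is normal and cocompact in `B`, then the image of
`Res(A)` is dense in `Res(B)`. -/
theorem discreteResidual_le_closure {ψ : A →* B} (hc : Continuous ψ)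
    (hi : Function.Injective ψ) (hn : ψ.range.Normal) {K : Set A} (hK : IsCompact K)
    (hKA : Subgroup.closure K = ⊤) {V : Subgroup B} (hV : IsOpen (V : Set B))
    (hVc : IsCompact (V : Set B)) (hVB : ∀ b, ∃ v ∈ V, ∃ a, v * ψ a = b) :
    discreteResidual B ≤ ((discreteResidual A).map ψ).topologicalClosure := by
  set R := ((discreteResidual A).map ψ).topologicalClosure with hR
  have hmn := map_discreteResidual_normal hc hi hn
  have hRn : R.Normal := Subgroup.is_normal_topologicalClosure _
  -- Such `W` can be chosen arbitrarily small and `R` is closed, so this suffices. The proof shows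
  -- that the normal core `Q` of `WR` is open.
  have key : ∀ W : Subgroup B, IsOpen (W : Set B) → (∀ v ∈ V, ∀ w ∈ W, v * w * v⁻¹ ∈ W) →
      discreteResidual B ≤ W ⊔ R := by
    intro W hW hVW
    have hVWR : ∀ v ∈ V, ∀ x ∈ W ⊔ R, v * x * v⁻¹ ∈ W ⊔ R := by
      intro v hv x hx
      obtain ⟨w, hw, r, hr, rfl⟩ := Subgroup.mem_sup_of_normal_right.1 hx
      have h := mul_mem (Subgroup.mem_sup_left (T := R) (hVW v hv w hw))
        (Subgroup.mem_sup_right (S := W) (hRn.conj_mem r hr v))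
      simpa [mul_assoc] using h
    set Q := (W ⊔ R).normalCore
    have hLo : IsOpen ((Q.comap ψ : Subgroup A) : Set A) := by
      obtain ⟨U, hU, hUc, hUW⟩ := exists_compact_open_subgroup_subset
        ((hW.preimage hc).mem_nhds (show ψ 1 ∈ W by simp))
      -- `ψ(L)` lies in `WR` and `L` is normal in `A`; as `B = V ψ(A)` and `V` normalizes `WR`, all
      -- conjugates of `ψ(L)` stay in `WR`, so `L ≤ ψ⁻¹(Q)`.
      obtain ⟨L, hLn, hLo, hL⟩ := exists_open_normal_le_sup_discreteResidual hK hKA hU hUc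
      have hLW : ∀ l ∈ L, ψ l ∈ W ⊔ R := by
        intro l hl
        obtain ⟨u, hu, r, hr, rfl⟩ := Subgroup.mem_sup_of_normal_right.1 (hL hl)
        rw [map_mul]
        exact mul_mem (Subgroup.mem_sup_left (hUW hu))
          (Subgroup.mem_sup_right (Subgroup.le_topologicalClosure _ ⟨r, hr, rfl⟩))
      refine Subgroup.isOpen_mono (H₁ := L) (fun l hl b => ?_) hLo
      obtain ⟨v, hv, a, rfl⟩ := hVB b
      have := hVWR v hv _ (hLW _ (hLn.conj_mem l hl a))
      simpa [mul_assoc] using this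
    -- Elements near `1` fix the compact generating set modulo `ψ⁻¹(Q)`, hence act trivially on `A /
    -- ψ⁻¹(Q)`. For `w ∈ W` among them, `ψ(a) w ψ(a)⁻¹` is a commutator in `Q` times `w`, so it lies
    -- in `WR`; conjugating by `V` then gives `w ∈ Q`.
    have hact : ∀ᶠ b in 𝓝 (1 : B), ∀ a ∈ K, a⁻¹ * conjAut ψ hi hn b a ∈ Q.comap ψ := by
      refine hK.eventually_forall_of_forall_eventually fun a _ => ?_
      have hcont : Continuous fun p : B × A => p.2⁻¹ * conjAut ψ hi hn p.1 p.2 :=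
        continuous_snd.inv.mul (continuous_conjAut hi hn hc)
      exact hcont.continuousAt.eventually_mem (hLo.mem_nhds (by simp))
    refine (discreteResidual_le inferInstance (Q.isOpen_of_mem_nhds (g := 1) ?_)).trans
      (Subgroup.normalCore_le _)
    filter_upwards [hact, hW.mem_nhds W.one_mem] with w hwK hw b
    obtain ⟨v, hv, a, rfl⟩ := hVB b
    have heq : QuotientGroup.mk' (Q.comap ψ) =
        (QuotientGroup.mk' (Q.comap ψ)).comp (conjAut ψ hi hn w).toMonoidHom :=
      MonoidHom.eq_of_eqOn_dense hKA fun a ha => QuotientGroup.eq.2 (hwK a ha)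
    have ha : a⁻¹⁻¹ * conjAut ψ hi hn w a⁻¹ ∈ Q.comap ψ :=
      QuotientGroup.eq.1 (DFunLike.congr_fun heq a⁻¹)
    have ha' : ψ a * (w * (ψ a)⁻¹ * w⁻¹) ∈ Q := by simpa [mul_assoc] using ha
    have := hVWR v hv _ (mul_mem (Subgroup.normalCore_le _ ha') (Subgroup.mem_sup_left hw))
    simpa [mul_assoc] using this
  intro x hx
  by_contra hxR
  obtain ⟨W, hW, hWU, hVW⟩ := exists_open_le_normalized hV hVc (U := {w : B | w⁻¹ * x ∈ (R : Set B)ᶜ})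
    (((Subgroup.isClosed_topologicalClosure _).isOpen_compl.preimage
      (by fun_prop : Continuous fun w : B => w⁻¹ * x)).mem_nhds
      (by rwa [Set.mem_preimage, inv_one, one_mul]))
  obtain ⟨w, hw, r, hr, rfl⟩ := Subgroup.mem_sup_of_normal_right.1 (key W hW hVW hx)
  exact hWU hw (by simpa using hr)

theorem exists_isCompact_closure_eq_top {G : Type*} [Group G] [TopologicalSpace G] {O : Subgroup G}
    (hO : IsClosed (O : Set G)) (h : ∃ K : Set G, IsCompact K ∧ Subgroup.closure K = O) :
    ∃ K : Set O, IsCompact K ∧ Subgroup.closure K = ⊤ := by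
  obtain ⟨K, hK, rfl⟩ := h
  exact ⟨_, hO.isClosedEmbedding_subtypeVal.isCompact_preimage hK,
    Subgroup.closure_closure_coe_preimage⟩

/-- The group `A` has an exhaustion by compactly generated open subgroups that are invariant under
a given compact group of conjugations. -/
theorem exists_invariant_isCompGenExhaustion {ψ : A →* B} (hc : Continuous ψ)
    (hi : Function.Injective ψ) (hn : ψ.range.Normal) {V : Subgroup B}
    (hVc : IsCompact (V : Set B)) :
    ∃ O : ℕ → Subgroup A, IsCompGenExhaustion O ∧
      ∀ n, ∀ v ∈ V, ∀ a ∈ O n, conjAut ψ hi hn v a ∈ O n := by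
  obtain ⟨U, hU, hUc, -⟩ := exists_compact_open_subgroup_subset (Filter.univ_mem (f := 𝓝 (1 : A)))
  let act : B × A → A := fun p => conjAut ψ hi hn p.1 p.2
  let S : ℕ → Set A := fun n => U ∪ compactCovering A n
  -- The `V`-orbit of a compact set is compact and generates a `V`-invariant subgroup; including `U`
  -- in `S n` makes it open.
  let K : ℕ → Set A := fun n => act '' ((V : Set B) ×ˢ S n)
  have hSK : ∀ n, S n ⊆ K n := fun n s hs => ⟨(1, s), ⟨V.one_mem, hs⟩, by simp [act]⟩
  refine ⟨fun n => Subgroup.closure (K n), ⟨fun m n hmn => ?_, fun n => ?_, fun n => ?_, fun g => ?_⟩,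
    fun n v hv => ?_⟩
  · exact Subgroup.closure_mono (Set.image_mono (Set.prod_mono subset_rfl
      (Set.union_subset_union_right _ (compactCovering_subset A hmn))))
  · exact Subgroup.isOpen_mono (H₁ := U)
      (fun u hu => Subgroup.subset_closure (hSK n (.inl hu))) hU
  · exact ⟨K n, (hVc.prod (hUc.union (isCompact_compactCovering A n))).image
      (continuous_conjAut hi hn hc), rfl⟩
  · obtain ⟨n, hn'⟩ := exists_mem_compactCovering g
    exact ⟨n, Subgroup.subset_closure (hSK n (.inr hn'))⟩
  · have : Subgroup.closure (K n) ≤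
        (Subgroup.closure (K n)).comap (conjAut ψ hi hn v).toMonoidHom := by
      rw [Subgroup.closure_le]
      rintro _ ⟨⟨v', s⟩, ⟨hv', hs⟩, rfl⟩
      exact Subgroup.subset_closure ⟨(v * v', s), ⟨mul_mem hv hv', hs⟩, by simp [act]⟩
    exact this

theorem exists_isCompGenExhaustion (G : Type*) [Group G] [TopologicalSpace G] [IsTDLCSC G] :
    ∃ O : ℕ → Subgroup G, IsCompGenExhaustion O := by
  obtain ⟨O, hO, -⟩ := exists_invariant_isCompGenExhaustion (A := G) (B := G)
    (ψ := MonoidHom.id G) continuous_id Function.injective_id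
    (by rw [MonoidHom.range_eq_top.2 Function.surjective_id]; infer_instance)
    (V := ⊥) (by simp)
  exact ⟨O, hO⟩

end Residual

/-! ### Transfer of the decomposition rank. -/

section Rank

theorem IsNormalCompressionMap.discreteResidual {A B : Type u} [Group A] [TopologicalSpace A]
    [IsTDLCSC A] [Group B] [TopologicalSpace B] [IsTDLCSC B] {ψ : A →* B} (hc : Continuous ψ)
    (hi : Function.Injective ψ) (hn : ψ.range.Normal) {K : Set A} (hK : IsCompact K)
    (hKA : Subgroup.closure K = ⊤) {V : Subgroup B} (hV : IsOpen (V : Set B))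
    (hVc : IsCompact (V : Set B)) (hVB : ∀ b, ∃ v ∈ V, ∃ a, v * ψ a = b) :
    IsNormalCompressionMap ((ψ.comp (discreteResidual A).subtype).codRestrict (discreteResidual B)
      fun a => map_discreteResidual_le hc ⟨a, a.2, rfl⟩) where
  continuous := Continuous.subtype_mk (hc.comp continuous_subtype_val) _
  injective := fun a b hab => Subtype.ext (hi (congrArg Subtype.val hab))
  denseRange := fun x => by
    rw [IsInducing.subtypeVal.closure_eq_preimage_closure_image, ← Set.range_comp]
    have := discreteResidual_le_closure hc hi hn hK hKA hV hVc hVB x.2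
    refine closure_mono ?_ this
    rintro _ ⟨a, ha, rfl⟩
    exact ⟨⟨a, ha⟩, rfl⟩
  normal_range := by
    refine ⟨?_⟩
    rintro _ ⟨a, rfl⟩ b
    exact ⟨⟨_, conjAut_mem_discreteResidual hc hi hn b a.2⟩,
      Subtype.ext (map_conjAut hi hn (b : B) (a : A))⟩

/-- The dense image meets the open coset `V x`. -/
theorem IsNormalCompressionMap.exists_mul_eq {G H : Type u} [Group G] [TopologicalSpace G]
    [Group H] [TopologicalSpace H] [IsTopologicalGroup H] {ψ : G →* H}
    (h : IsNormalCompressionMap ψ) {V : Subgroup H} (hV : IsOpen (V : Set H)) (x : H) :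
    ∃ v ∈ V, ∃ g, v * ψ g = x := by
  obtain ⟨g, hg⟩ := h.denseRange.exists_mem_open
    (hV.preimage (by fun_prop : Continuous fun y : H => x * y⁻¹)) ⟨x, by simp⟩
  exact ⟨_, hg, g, by simp⟩

/-- A group with a rank bounds the rank of every normal compression of a group mapping injectively
into it. -/
theorem HasDecompositionRank.exists_le_of_normalCompression {X : Type u} [Group X]
    [TopologicalSpace X] {α : Ordinal.{0}} (hX : HasDecompositionRank X α) :
    ∀ {G H : Type u} [Group G] [TopologicalSpace G] [IsTDLCSC G] [Group H] [TopologicalSpace H]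
      [IsTDLCSC H] (φ : G →* X) (ψ : G →* H), Continuous φ → Function.Injective φ →
      IsNormalCompressionMap ψ → ∃ β ≤ α, HasDecompositionRank H β := by
  induction hX with
  | trivial X =>
    intro G H _ _ _ _ _ _ φ ψ hφ hφi hψ
    have : Subsingleton G := hφi.subsingleton
    have : Subsingleton H := by
      refine subsingleton_of_forall_eq 1 fun x => ?_
      have hx : x ∈ closure (Set.range ψ) := hψ.denseRange x
      have hr : Set.range ψ = {1} :=
        Set.eq_singleton_iff_unique_mem.2 ⟨⟨1, map_one ψ⟩, by
          rintro _ ⟨g, rfl⟩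
          rw [Subsingleton.elim g 1, map_one]⟩
      rwa [hr, closure_singleton] at hx
    exact ⟨1, le_rfl, .trivial H⟩
  | step X P hP γ hγ ih =>
    intro G H _ _ _ _ _ _ φ ψ hφ hφi hψ
    rcases subsingleton_or_nontrivial H with hH | hH
    · exact ⟨1, le_add_self, .trivial H⟩
    obtain ⟨V, hV, hVc, -⟩ :=
      exists_compact_open_subgroup_subset (Filter.univ_mem (f := 𝓝 (1 : H)))
    obtain ⟨O, hO, hOV⟩ := exists_invariant_isCompGenExhaustion hψ.continuous hψ.injective
      hψ.normal_range hVc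
    -- By `V`-invariance of `O n` this join is the product set `V ψ(O n)`, in which `ψ(O n)` is
    -- normal and cocompact.
    let S : ℕ → Subgroup H := fun n => V ⊔ (O n).map ψ
    have hVn : ∀ n, V ≤ Subgroup.normalizer ((O n).map ψ : Set H) := by
      have h : ∀ n, ∀ v ∈ V, ∀ x ∈ (O n).map ψ, v * x * v⁻¹ ∈ (O n).map ψ := by
        rintro n v hv _ ⟨a, ha, rfl⟩
        exact ⟨_, hOV n v hv a ha, map_conjAut hψ.injective hψ.normal_range v a⟩
      refine fun n v hv => Subgroup.mem_normalizer_iff.2 fun x => ⟨h n v hv x, fun hx => ?_⟩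
      simpa [mul_assoc] using h n v⁻¹ (inv_mem hv) _ hx
    have hSO : ∀ n x, x ∈ S n → ∃ v ∈ V, ∃ a ∈ O n, v * ψ a = x := by
      intro n x hx
      have hx' : x ∈ (V : Set H) * ((O n).map ψ : Set H) := by
        rwa [← Subgroup.coe_mul_of_left_le_normalizer_right _ _ (hVn n)]
      obtain ⟨v, hv, _, ⟨a, ha, rfl⟩, rfl⟩ := hx'
      exact ⟨v, hv, a, ha, rfl⟩
    have hSo : ∀ n, IsOpen (S n : Set H) := fun n => Subgroup.isOpen_mono le_sup_left hV
    have hS : IsCompGenExhaustion S := by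
      refine ⟨fun m n hmn => sup_le_sup_left (Subgroup.map_mono (hO.mono hmn)) V, hSo,
        fun n => ?_, fun x => ?_⟩
      · obtain ⟨K, hK, hKO⟩ := hO.compactlyGenerated n
        refine ⟨V ∪ ψ '' K, hVc.union (hK.image hψ.continuous), ?_⟩
        rw [Subgroup.closure_union, Subgroup.closure_eq, ← MonoidHom.map_closure, hKO]
      · obtain ⟨v, hv, g, rfl⟩ := hψ.exists_mul_eq hV x
        obtain ⟨n, hn⟩ := hO.cover g
        exact ⟨n, mul_mem (Subgroup.mem_sup_left hv) (Subgroup.mem_sup_right ⟨g, hn, rfl⟩)⟩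
    have hstep : ∀ n, ∃ β ≤ ⨆ i, γ i, HasDecompositionRank (discreteResidual (S n)) β := by
      intro n
      have hOc := (O n).isClosed_of_isOpen (hO.isOpen n)
      have : IsTDLCSC (O n) := .subgroup hOc
      have : IsTDLCSC (S n) := .subgroup ((S n).isClosed_of_isOpen (hSo n))
      have : IsTDLCSC (discreteResidual (O n)) := .subgroup isClosed_discreteResidual
      have : IsTDLCSC (discreteResidual (S n)) := .subgroup isClosed_discreteResidual
      obtain ⟨K, hK, hKO⟩ := hO.compactlyGenerated n
      -- A compact generating set of `O n` lands in a single `P i`, so `Res(O n)` injects into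
      -- `Res(P i)`, to which the induction hypothesis applies.
      obtain ⟨i, hi⟩ := (hK.image hφ).elim_directed_cover (fun i => (P i : Set X)) hP.isOpen
        (fun g _ => Set.mem_iUnion.2 (hP.cover g))
        (Monotone.directed_le fun a b hab => hP.mono hab)
      have hle : O n ≤ (P i).comap φ := by
        rw [← hKO, Subgroup.closure_le]
        exact fun k hk => hi ⟨k, hk, rfl⟩
      let φ₁ : O n →* P i := (φ.comp (O n).subtype).codRestrict (P i) fun x => hle x.2
      have hφ₁ : Continuous φ₁ := Continuous.subtype_mk (hφ.comp continuous_subtype_val) _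
      let φ₂ : discreteResidual (O n) →* discreteResidual (P i) :=
        (φ₁.comp (discreteResidual (O n)).subtype).codRestrict _
          fun a => map_discreteResidual_le hφ₁ ⟨a, a.2, rfl⟩
      let ψ₁ : O n →* S n := (ψ.comp (O n).subtype).codRestrict (S n)
        fun x => Subgroup.mem_sup_right ⟨x, x.2, rfl⟩
      have hψ₁ : Continuous ψ₁ :=
        Continuous.subtype_mk (hψ.continuous.comp continuous_subtype_val) _
      have hψ₁i : Function.Injective ψ₁ := fun a b hab =>
        Subtype.ext (hψ.injective (congrArg Subtype.val hab))
      have hψ₁n : ψ₁.range.Normal := by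
        have : ψ₁.range = ((O n).map ψ).subgroupOf (S n) := by
          ext x
          refine ⟨?_, ?_⟩
          · rintro ⟨a, rfl⟩
            exact ⟨a, a.2, rfl⟩
          · rintro ⟨a, ha, hax⟩
            exact ⟨⟨a, ha⟩, Subtype.ext hax⟩
        rw [this]
        exact Subgroup.normal_subgroupOf_of_le_normalizer
          (sup_le (hVn n) Subgroup.le_normalizer)
      obtain ⟨K', hK', hKO'⟩ := exists_isCompact_closure_eq_top hOc ⟨K, hK, hKO⟩
      have hcomp := IsNormalCompressionMap.discreteResidual hψ₁ hψ₁i hψ₁n hK' hKO'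
        (V := V.subgroupOf (S n)) (hV.preimage continuous_subtype_val)
        (((S n).isClosed_of_isOpen (hSo n)).isClosedEmbedding_subtypeVal.isCompact_preimage hVc)
        (by
          rintro ⟨x, hx⟩
          obtain ⟨v, hv, a, ha, rfl⟩ := hSO n x hx
          exact ⟨⟨v, Subgroup.mem_sup_left hv⟩, hv, ⟨a, ha⟩, rfl⟩)
      obtain ⟨β, hβ, hβ'⟩ := ih i φ₂ _
        (Continuous.subtype_mk (hφ₁.comp continuous_subtype_val) _)
        (fun a b hab => Subtype.ext (Subtype.ext
          (hφi (congrArg Subtype.val (congrArg Subtype.val hab))))) hcomp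
      exact ⟨β, hβ.trans (le_ciSup Ordinal.bddAbove_of_small i), hβ'⟩
    choose β hβ hβ' using hstep
    exact ⟨_, add_le_add (ciSup_le hβ) le_rfl, .step H S hS β hβ'⟩

/-- The bound with `X = G` and monotonicity give one direction. For the other, take `X = H` and
regard `G` as a compression of itself: `G` then has some rank, which the first direction identifies.
-/
theorem HasDecompositionRank.normalCompression_iff {G H : Type u} [Group G] [TopologicalSpace G]
    [IsTDLCSC G] [Group H] [TopologicalSpace H] [IsTDLCSC H] {ψ : G →* H}
    (hψ : IsNormalCompressionMap ψ) (α : Ordinal.{0}) :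
    HasDecompositionRank G α ↔ HasDecompositionRank H α := by
  have hG : ∀ {β}, HasDecompositionRank G β → HasDecompositionRank H β := fun {β} h => by
    obtain ⟨γ, hγ, hH⟩ := h.exists_le_of_normalCompression (MonoidHom.id G) ψ continuous_id
      Function.injective_id hψ
    rwa [← hγ.antisymm (hH.le_of_injective h ψ hψ.continuous hψ.injective)]
  refine ⟨hG, fun h => ?_⟩
  obtain ⟨γ, -, hγ⟩ := h.exists_le_of_normalCompression ψ (MonoidHom.id G) hψ.continuous
    hψ.injective
    { continuous := continuous_id
      injective := Function.injective_id
      denseRange := Function.surjective_id.denseRange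
      normal_range := by
        rw [MonoidHom.range_eq_top.2 Function.surjective_id]
        infer_instance }
  rwa [h.unique (hG hγ)]

theorem decompositionRank_eq_of_isNormalCompression {G H : Type u} [Group G] [TopologicalSpace G]
    [IsTDLCSC G] [Group H] [TopologicalSpace H] [IsTDLCSC H] (h : IsNormalCompression H G) :
    decompositionRank G = decompositionRank H := by
  obtain ⟨ψ, hψ⟩ := h
  by_cases hG : ∃ α, HasDecompositionRank G α
  · obtain ⟨α, hα⟩ := hG
    rw [hα.decompositionRank_eq,
      ((HasDecompositionRank.normalCompression_iff hψ α).1 hα).decompositionRank_eq]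
  · have hH : ¬∃ α, HasDecompositionRank H α := by
      simpa only [HasDecompositionRank.normalCompression_iff hψ] using hG
    -- Neither group has a rank, so both sides are the default `ω₁`.
    rw [decompositionRank, decompositionRank, dif_neg hG, dif_neg hH]

end Rank

/-! ### Elementary groups and continuous injections. -/

section Elementary

/-- The first isomorphism theorem for continuous surjective homomorphisms of t.d.l.c.s.c. groups. -/
noncomputable def IsTDLCSC.quotientKerEquiv {P Y : Type*} [Group P] [TopologicalSpace P]
    [IsTDLCSC P] [Group Y] [TopologicalSpace Y] [IsTDLCSC Y] (f : P →* Y) (hf : Continuous f)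
    (hs : Function.Surjective f) : P ⧸ f.ker ≃ₜ* Y where
  toMulEquiv := QuotientGroup.quotientKerEquivOfSurjective f hs
  continuous_toFun := (QuotientGroup.isQuotientMap_mk f.ker).continuous_iff.2 hf
  continuous_invFun := by
    have hq : IsQuotientMap f := (f.isOpenMap_of_sigmaCompact hs hf).isQuotientMap hf hs
    refine hq.continuous_iff.2 ?_
    have : (QuotientGroup.quotientKerEquivOfSurjective f hs).invFun ∘ f =
        (QuotientGroup.mk : P → P ⧸ f.ker) := funext fun p =>
      (QuotientGroup.quotientKerEquivOfSurjective f hs).symm_apply_apply (p : P ⧸ f.ker)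
    rw [this]
    exact QuotientGroup.continuous_mk

theorem isClosed_ker {P Y : Type*} [Group P] [TopologicalSpace P] [Group Y]
    [TopologicalSpace Y] [T1Space Y] {f : P →* Y} (hf : Continuous f) :
    IsClosed (f.ker : Set P) :=
  isClosed_singleton.preimage hf

theorem IsElementary.of_surjective {P Y : Type u} [Group P] [TopologicalSpace P]
    [IsTDLCSC P] [Group Y] [TopologicalSpace Y] [IsTDLCSC Y] (f : P →* Y) (hf : Continuous f)
    (hs : Function.Surjective f) (hP : IsElementary P) : IsElementary Y :=
  .congr _ _ (IsTDLCSC.quotientKerEquiv f hf hs) (.quotient P f.ker (isClosed_ker hf) hP)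

theorem IsElementary.of_ker {P Y : Type u} [Group P] [TopologicalSpace P]
    [IsTDLCSC P] [Group Y] [TopologicalSpace Y] [IsTDLCSC Y] (f : P →* Y) (hf : Continuous f)
    (hs : Function.Surjective f) (hk : IsElementary f.ker) (hY : IsElementary Y) :
    IsElementary P :=
  .extension P f.ker (isClosed_ker hf) hk (.congr _ _ (IsTDLCSC.quotientKerEquiv f hf hs).symm hY)

theorem IsElementary.isTDLCSC {X : Type u} [Group X] [TopologicalSpace X] (h : IsElementary X) :
    IsTDLCSC X := by
  induction h with
  | profinite => assumption
  | discrete G =>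
    exact { (inferInstance : IsTopologicalGroup G), (inferInstance : T2Space G),
      (inferInstance : TotallyDisconnectedSpace G), (inferInstance : LocallyCompactSpace G),
      (inferInstance : SecondCountableTopology G) with }
  | congr G H e _ ih => exact .of_equiv e
  | closedSubgroup G H hH _ ih => exact .subgroup hH
  | quotient G N hN _ ih => exact .quotient hN
  | extension => assumption
  | union => assumption

/-- With trivial residual, a compact open subgroup contains an open normal subgroup, making the
group profinite-by-discrete. -/
theorem isElementary_of_discreteResidual_eq_bot {G : Type u} [Group G] [TopologicalSpace G]
    [IsTDLCSC G] {K : Set G} (hK : IsCompact K) (hKG : Subgroup.closure K = ⊤)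
    (hG : discreteResidual G = ⊥) : IsElementary G := by
  obtain ⟨U, hU, hUc, -⟩ := exists_compact_open_subgroup_subset (Filter.univ_mem (f := 𝓝 (1 : G)))
  obtain ⟨L, hLn, hLo, hL⟩ := exists_open_normal_le_sup_discreteResidual hK hKG hU hUc
  rw [hG, sup_bot_eq] at hL
  have hLc := L.isClosed_of_isOpen hLo
  have : CompactSpace L := isCompact_iff_compactSpace.1 (hUc.of_isClosed_subset hLc hL)
  have : IsTDLCSC L := .subgroup hLc
  have : DiscreteTopology (G ⧸ L) := QuotientGroup.discreteTopology hLo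
  have : Countable (G ⧸ L) := countable_of_Lindelof_of_discrete
  exact .extension G L hLc (.profinite L) (.discrete (G ⧸ L))

theorem discreteResidual_eq_bot_of_injective {G P : Type*} [Group G] [TopologicalSpace G]
    [Group P] [TopologicalSpace P] [IsTDLCSC P] [CompactSpace P] {ψ : G →* P} (hψ : Continuous ψ)
    (hi : Function.Injective ψ) : discreteResidual G = ⊥ := by
  refine eq_bot_iff.2 fun x hx => ?_
  by_contra hx1
  have hx1 : ψ x ≠ 1 := fun h => hx1 (hi (h.trans (map_one ψ).symm))
  obtain ⟨N, hN⟩ := ProfiniteGrp.exist_openNormalSubgroup_sub_open_nhds_of_one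
    (isOpen_compl_singleton (x := ψ x)) hx1.symm
  exact hN (discreteResidual_le (N := N.toSubgroup.comap ψ) (N.isNormal'.comap ψ)
    (N.isOpen.preimage hψ) hx) rfl

/-- A t.d.l.c.s.c. group that maps injectively into an elementary group is elementary. -/
theorem IsElementary.of_injective {X : Type u} [Group X] [TopologicalSpace X]
    (hX : IsElementary X) : ∀ {Y : Type u} [Group Y] [TopologicalSpace Y] [IsTDLCSC Y]
      (ψ : Y →* X), Continuous ψ → Function.Injective ψ → IsElementary Y := by
  induction hX with
  | profinite X =>
    intro Y _ _ _ ψ hψ hi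
    -- `Y` need not be compact, but its compactly generated open subgroups are residually discrete
    -- because they inject into a profinite group.
    obtain ⟨O, hO⟩ := exists_isCompGenExhaustion Y
    refine .union Y O hO.mono hO.isOpen hO.cover fun n => ?_
    have hc := (O n).isClosed_of_isOpen (hO.isOpen n)
    have : IsTDLCSC (O n) := .subgroup hc
    obtain ⟨K, hK, hKO⟩ := exists_isCompact_closure_eq_top hc (hO.compactlyGenerated n)
    exact isElementary_of_discreteResidual_eq_bot hK hKO (discreteResidual_eq_bot_of_injective
      (ψ := ψ.comp (O n).subtype) (hψ.comp continuous_subtype_val) (hi.comp Subtype.val_injective))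
  | discrete X =>
    intro Y _ _ _ ψ hψ hi
    have : DiscreteTopology Y := .of_continuous_injective hψ hi
    have : Countable Y := hi.countable
    exact .discrete Y
  | congr X X' e _ ih =>
    intro Y _ _ _ ψ hψ hi
    exact ih (e.symm.toMulEquiv.toMonoidHom.comp ψ) (e.symm.continuous.comp hψ)
      (e.symm.injective.comp hi)
  | closedSubgroup X X' hX' _ ih =>
    intro Y _ _ _ ψ hψ hi
    exact ih (X'.subtype.comp ψ) (continuous_subtype_val.comp hψ) (Subtype.val_injective.comp hi)
  | quotient X N hN hX ih =>
    intro Y _ _ _ ψ hψ hi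
    have := hX.isTDLCSC
    have : IsTDLCSC (X ⧸ N) := .quotient hN
    have : IsTDLCSC (Y × X) := .prod
    -- The fibre product of `Y` and `X` over `X ⧸ N` injects into `X`, since `ψ` is injective, and
    -- surjects onto `Y`.
    let P : Subgroup (Y × X) :=
      (ψ.comp (MonoidHom.fst Y X)).eqLocus ((QuotientGroup.mk' N).comp (MonoidHom.snd Y X))
    have hP : IsClosed (P : Set (Y × X)) := isClosed_eq (hψ.comp continuous_fst)
      (QuotientGroup.continuous_mk.comp continuous_snd)
    have : IsTDLCSC P := .subgroup hP
    refine .of_surjective ((MonoidHom.fst Y X).comp P.subtype)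
      (continuous_fst.comp continuous_subtype_val) (fun y => ?_)
      (ih ((MonoidHom.snd Y X).comp P.subtype) (continuous_snd.comp continuous_subtype_val) ?_)
    · obtain ⟨x, hx⟩ := QuotientGroup.mk'_surjective N (ψ y)
      exact ⟨⟨(y, x), hx.symm⟩, rfl⟩
    · rintro ⟨⟨y, x⟩, hp⟩ ⟨⟨y', x'⟩, hp'⟩ (rfl : x = x')
      exact Subtype.ext (Prod.ext (hi (Eq.trans hp hp'.symm)) rfl)
  | extension X N hN _ _ ih₁ ih₂ =>
    intro Y _ _ _ ψ hψ hi
    have hM : IsClosed ((N.comap ψ : Subgroup Y) : Set Y) := hN.preimage hψ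
    have : IsTDLCSC (N.comap ψ) := .subgroup hM
    have : IsTDLCSC (Y ⧸ N.comap ψ) := .quotient hM
    refine .extension Y (N.comap ψ) hM
      (ih₁ ((ψ.comp (N.comap ψ).subtype).codRestrict N fun y => y.2)
        (Continuous.subtype_mk (hψ.comp continuous_subtype_val) _)
        fun a b hab => Subtype.ext (hi (congrArg Subtype.val hab)))
      (ih₂ (QuotientGroup.map (N.comap ψ) N ψ le_rfl)
        ((QuotientGroup.isQuotientMap_mk _).continuous_iff.2
          (QuotientGroup.continuous_mk.comp hψ)) ?_)
    rw [injective_iff_map_eq_one]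
    intro q hq
    obtain ⟨y, rfl⟩ := QuotientGroup.mk_surjective q
    exact (QuotientGroup.eq_one_iff y).2 ((QuotientGroup.eq_one_iff (ψ y)).1 hq)
  | union X O mono isOpen cover _ ih =>
    intro Y _ _ _ ψ hψ hi
    have ho : ∀ n, IsOpen (((O n).comap ψ : Subgroup Y) : Set Y) := fun n =>
      (isOpen n).preimage hψ
    refine .union Y (fun n => (O n).comap ψ) (fun m n hmn => Subgroup.comap_mono (mono hmn))
      ho (fun y => cover (ψ y)) fun n => ?_
    have : IsTDLCSC ((O n).comap ψ) := .subgroup (Subgroup.isClosed_of_isOpen _ (ho n))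
    exact ih n ((ψ.comp ((O n).comap ψ).subtype).codRestrict (O n) fun y => y.2)
      (Continuous.subtype_mk (hψ.comp continuous_subtype_val) _)
      fun a b hab => Subtype.ext (hi (congrArg Subtype.val hab))

end Elementary

/-! ### Topological semidirect products. -/

section SemidirectProduct

variable {G V : Type*} [Group G] [TopologicalSpace G] [Group V] [TopologicalSpace V]
  {φ : V →* MulAut G}

/-- The product topology on a semidirect product. -/
instance SemidirectProduct.instTopologicalSpace : TopologicalSpace (G ⋊[φ] V) :=
  .induced SemidirectProduct.equivProd inferInstance

/-- A semidirect product is homeomorphic to the product. -/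
def SemidirectProduct.homeomorphProd : G ⋊[φ] V ≃ₜ G × V :=
  SemidirectProduct.equivProd.toHomeomorphOfIsInducing ⟨rfl⟩

theorem SemidirectProduct.continuous_left : Continuous (left : G ⋊[φ] V → G) :=
  continuous_fst.comp (homeomorphProd (φ := φ)).continuous

theorem SemidirectProduct.continuous_right : Continuous (right : G ⋊[φ] V → V) :=
  continuous_snd.comp (homeomorphProd (φ := φ)).continuous

theorem SemidirectProduct.continuous_iff {X : Type*} [TopologicalSpace X] {f : X → G ⋊[φ] V} :
    Continuous f ↔ Continuous (fun x => (f x).left) ∧ Continuous (fun x => (f x).right) := by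
  rw [← (homeomorphProd (φ := φ)).comp_continuous_iff, continuous_prodMk.symm]
  rfl

theorem SemidirectProduct.isTDLCSC [IsTDLCSC G] [IsTDLCSC V]
    (hφ : Continuous fun p : V × G => φ p.1 p.2) : IsTDLCSC (G ⋊[φ] V) := by
  have e := homeomorphProd (φ := φ)
  refine
    { continuous_mul := continuous_iff.2 ⟨?_, ?_⟩
      continuous_inv := continuous_iff.2 ⟨?_, ?_⟩
      toT2Space := e.symm.t2Space
      toTotallyDisconnectedSpace := e.symm.totallyDisconnectedSpace
      toLocallyCompactSpace := e.isClosedEmbedding.locallyCompactSpace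
      toSecondCountableTopology := e.isInducing.secondCountableTopology }
  · exact (continuous_left.comp continuous_fst).mul
      (hφ.comp ((continuous_right.comp continuous_fst).prodMk
        (continuous_left.comp continuous_snd)))
  · exact (continuous_right.comp continuous_fst).mul (continuous_right.comp continuous_snd)
  · exact hφ.comp (continuous_right.inv.prodMk continuous_left.inv)
  · exact continuous_right.inv

end SemidirectProduct

/-! ### Elementarity of a normal compression. -/

section NormalCompression

theorem SemidirectProduct.isElementary {G V : Type u} [Group G] [TopologicalSpace G] [IsTDLCSC G]
    [Group V] [TopologicalSpace V] [IsTDLCSC V] {φ : V →* MulAut G}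
    (hφ : Continuous fun p : V × G => φ p.1 p.2) (hG : IsElementary G) (hV : IsElementary V) :
    IsElementary (G ⋊[φ] V) := by
  have : IsTDLCSC (G ⋊[φ] V) := SemidirectProduct.isTDLCSC hφ
  have hr : Continuous (SemidirectProduct.rightHom : G ⋊[φ] V →* V) :=
    SemidirectProduct.continuous_right
  have hl : Continuous (SemidirectProduct.inl : G →* G ⋊[φ] V) :=
    SemidirectProduct.continuous_iff.2 ⟨continuous_id, continuous_const⟩
  refine .of_ker _ hr SemidirectProduct.rightHom_surjective ?_ hV
  have : IsTDLCSC (SemidirectProduct.rightHom : G ⋊[φ] V →* V).ker := .subgroup (isClosed_ker hr)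
  refine hG.of_surjective ((SemidirectProduct.inl : G →* G ⋊[φ] V).codRestrict
    (SemidirectProduct.rightHom : G ⋊[φ] V →* V).ker SemidirectProduct.rightHom_inl)
    (hl.subtype_mk _) ?_
  rintro ⟨x, hx⟩
  obtain ⟨g, rfl⟩ := SemidirectProduct.range_inl_eq_ker_rightHom.ge hx
  exact ⟨g, rfl⟩

/-- The maps `ψ` and `ι` combine to a continuous surjection from `G ⋊ V`, which is a topological
quotient map by the open mapping theorem for σ-compact groups. -/
theorem IsElementary.of_semidirectProduct {G V H : Type u} [Group G] [TopologicalSpace G]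
    [IsTDLCSC G] [Group V] [TopologicalSpace V] [IsTDLCSC V] [Group H] [TopologicalSpace H]
    [IsTDLCSC H] {φ : V →* MulAut G} (hφ : Continuous fun p : V × G => φ p.1 p.2) {ψ : G →* H}
    (hψ : Continuous ψ) {ι : V →* H} (hι : Continuous ι)
    (h : ∀ v, ψ.comp (φ v).toMonoidHom = (MulAut.conj (ι v)).toMonoidHom.comp ψ)
    (hs : ∀ x, ∃ v g, ι v * ψ g = x) (hG : IsElementary G) (hV : IsElementary V) :
    IsElementary H := by
  have : IsTDLCSC (G ⋊[φ] V) := SemidirectProduct.isTDLCSC hφ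
  refine (SemidirectProduct.isElementary hφ hG hV).of_surjective (SemidirectProduct.lift ψ ι h)
    ?_ fun x => ?_
  · exact (hψ.comp SemidirectProduct.continuous_left).mul
      (hι.comp SemidirectProduct.continuous_right)
  · obtain ⟨v, g, rfl⟩ := hs x
    refine ⟨SemidirectProduct.inr v * SemidirectProduct.inl g, ?_⟩
    rw [map_mul, SemidirectProduct.lift_inr, SemidirectProduct.lift_inl]

theorem IsNormalCompressionMap.isElementary {G H : Type u} [Group G] [TopologicalSpace G]
    [IsTDLCSC G] [Group H] [TopologicalSpace H] [IsTDLCSC H] {ψ : G →* H}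
    (hψ : IsNormalCompressionMap ψ) (hG : IsElementary G) : IsElementary H := by
  obtain ⟨V, hV, hVc, -⟩ := exists_compact_open_subgroup_subset (Filter.univ_mem (f := 𝓝 (1 : H)))
  have : CompactSpace V := isCompact_iff_compactSpace.1 hVc
  have : IsTDLCSC V := .subgroup (V.isClosed_of_isOpen hV)
  have hact : Continuous fun p : V × G => conjAut ψ hψ.injective hψ.normal_range p.1 p.2 :=
    (continuous_conjAut hψ.injective hψ.normal_range hψ.continuous).comp
      (f := fun p : V × G => ((p.1 : H), p.2)) (by fun_prop)
  refine .of_semidirectProduct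
    (φ := (conjAut ψ hψ.injective hψ.normal_range).comp V.subtype) (ψ := ψ) (ι := V.subtype) hact
    hψ.continuous continuous_subtype_val
    (fun v => MonoidHom.ext fun g => map_conjAut hψ.injective hψ.normal_range v g)
    (fun x => ?_) hG (.profinite V)
  obtain ⟨v, hv, g, h⟩ := hψ.exists_mul_eq hV x
  exact ⟨⟨v, hv⟩, g, h⟩

end NormalCompression

theorem proposition5p3 {G H : Type u} [Group G] [TopologicalSpace G] [IsTDLCSC G]
    [Group H] [TopologicalSpace H] [IsTDLCSC H] (hGH : IsNormalCompression H G)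
    (α : Ordinal.{0}) :
    (IsElementary G ∧ decompositionRank G = α) ↔ (IsElementary H ∧ decompositionRank H = α) := by
  rw [decompositionRank_eq_of_isNormalCompression hGH]
  obtain ⟨ψ, hψ⟩ := hGH
  exact and_congr_left' ⟨hψ.isElementary, fun h => h.of_injective ψ hψ.continuous hψ.injective⟩
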